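/- Let $n\ge 1$, $0<\alpha<n$ and $r=\frac{n}{n-\alpha}$. Let $\sigma$ be the area measure on the unit sphere $\mathbb S^{n-1}$ of $\mathbb R^n$ and $m$ Lebesgue measure on $\mathbb R^n$. Let $\Omega$ be a (real- or complex-valued) function on $\mathbb R^n\setminus\{0\}$ such that (1) $\Omega(tx)=\Omega(x)$ for all $t>0$ and $x\neq 0$; (2) $\int_{\mathbb S^{n-1}}\Omega(\theta)\,d\sigma(\theta)=0$; (3) $\Omega$ satisfies the $L^r_\alpha$-Dini condition: $\Omega\in L^r(\mathbb S^{n-1})$ and $\int_0^1\frac{\omega_1(\delta)}{\delta^{1+\alpha}}\,d\delta<\infty$, where $$\omega_1(\delta)=\sup_{\|\rho\|\le\delta}\int_{\mathbb S^{n-1}}|\Omega(\rho\theta)-\Omega(\theta)|\,d\sigma(\theta),$$ the supremum being taken over the rotations $\rho$ of $\mathbb R^n$ with $\|\rho\|:=\sup\{|\rho x'-x'|:x'\in\mathbb S^{n-1}\}\le\delta$. Let $\nu$ be a finite signed measure on $\mathbb R^n$ that is absolutely continuous with respect to Lebesgue measure. Then the integral $$T_{\Omega,\alpha}\nu(x)=\int_{\mathbb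 R^n}\frac{\Omega(x-y)}{|x-y|^{n-\alpha}}\,d\nu(y)$$ converges absolutely for almost every $x\in\mathbb R^n$, and $$\lim_{\lambda\to0_+}\lambda^{r}\,m\big(\{x\in\mathbb R^n:|T_{\Omega,\alpha}\nu(x)|>\lambda\}\big)=\frac1n\,\|\Omega\|_r^r\,|\nu(\mathbb R^n)|^r,$$ where $\|\Omega\|_r$ is the norm of $\Omega$ in $L^r(\mathbb S^{n-1},\sigma)$. -/

import Mathlib

open MeasureTheory Filter Topology Metric
open scoped ENNReal

noncomputable section

namespace FractionalRough

/-- The Euclidean space `ℝⁿ`. -/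
abbrev Eucl (n : ℕ) : Type := EuclideanSpace ℝ (Fin n)

/-- The area measure `σ` on the unit sphere `Sⁿ⁻¹` of `ℝⁿ`. -/
abbrev area (n : ℕ) : Measure (sphere (0 : Eucl n) 1) :=
  (volume : Measure (Eucl n)).toSphere

/-- A rotation of `ℝⁿ`: a linear isometry of determinant `1`. -/
def IsRotation {n : ℕ} (ρ : Eucl n ≃ₗᵢ[ℝ] Eucl n) : Prop :=
  LinearMap.det (ρ.toLinearEquiv : Eucl n →ₗ[ℝ] Eucl n) = 1

/-- `‖ρ‖ = sup {|ρ x' - x'| : x' ∈ Sⁿ⁻¹}`. The supremum is over a set that is bounded by `2`. -/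
def rotSize {n : ℕ} (ρ : Eucl n ≃ₗᵢ[ℝ] Eucl n) : ℝ :=
  ⨆ x : sphere (0 : Eucl n) 1, ‖ρ x - x‖

variable {𝕜 : Type*} [RCLike 𝕜] {n : ℕ}

/-- Homogeneity of degree zero: `Ω (t x) = Ω x` for `t > 0` and `x ≠ 0`. -/
def IsHomogeneousZero (Ω : Eucl n → 𝕜) : Prop :=
  ∀ t : ℝ, 0 < t → ∀ x : Eucl n, x ≠ 0 → Ω (t • x) = Ω x

/-- The `L¹` integral modulus of continuity
`ω₁(δ) = sup_{‖ρ‖ ≤ δ} ∫_{Sⁿ⁻¹} |Ω(ρ θ) - Ω(θ)| dσ(θ)`, the supremum being over rotations. -/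
def modulus (Ω : Eucl n → 𝕜) (δ : ℝ) : ℝ≥0∞ :=
  ⨆ (ρ : Eucl n ≃ₗᵢ[ℝ] Eucl n) (_ : IsRotation ρ) (_ : rotSize ρ ≤ δ),
    ∫⁻ θ : sphere (0 : Eucl n) 1, ‖Ω (ρ θ) - Ω θ‖ₑ ∂(area n)

/-- The `Lˢ_α`-Dini condition: `Ω ∈ Lˢ(Sⁿ⁻¹)` and `∫₀¹ ω₁(δ) / δ^(1+α) dδ < ∞`. -/
structure DiniCondition (s : ℝ≥0∞) (α : ℝ) (Ω : Eucl n → 𝕜) : Prop where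
  memLp : MemLp (fun θ : sphere (0 : Eucl n) 1 => Ω θ) s (area n)
  dini : ∫⁻ δ in Set.Ioo (0 : ℝ) 1, modulus Ω δ / ENNReal.ofReal (δ ^ (1 + α)) < ∞

/-- The kernel `Ω(z) / |z|^(n-α)`. -/
def kernel (Ω : Eucl n → 𝕜) (α : ℝ) (z : Eucl n) : 𝕜 :=
  (‖z‖ ^ ((n : ℝ) - α))⁻¹ • Ω z

/-- `T_{Ω,α} ν (x) = ∫ Ω(x-y) / |x-y|^(n-α) dν(y)` for a finite signed measure `ν`. -/
def fracIntegral (Ω : Eucl n → 𝕜) (α : ℝ) (ν : SignedMeasure (Eucl n)) (x : Eucl n) : 𝕜 :=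
  ∫ᵛ y, kernel Ω α (x - y) ∂<•ν

end FractionalRough

end

/-! The kernel `K` is homogeneous of degree `α - n`, so with `t = s ^ (1/(n-α))` scaling turns `s ^
r * m {|Tν| > s}` into `m {u | |∫ K (u - t y) dν(y)| > 1}` (`volume_lt_norm_fracIntegral`). As `t →
0` the dilated measures concentrate at the origin, and the integral converges in measure to `ν(ℝⁿ)
K(u)` (`tendstoInMeasure_integral_dilated_translate`). Polar coordinates give `m {|K| > s} = s ^
(-r) ‖Ω‖_r^r / n` (`volume_lt_norm_kernel`), which is continuous in `s > 0`, so the distribution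
functions converge at height `1`.

For the convergence in measure, `K` is cut at height `η`. The upper part is in `L¹` because `r > 1`,
and continuity of translations with Markov's inequality handles it. The lower part contributes at
most a constant times `η |ν|(ℝⁿ)`. -/

namespace FractionalRough

/-! ### Truncation, and null sets under translation. -/

section Truncation

variable {X F : Type*} [NormedAddCommGroup F] {K : X → F} {η : ℝ}

theorem stronglyMeasurable_truncation [MeasurableSpace X] (hK : StronglyMeasurable K) (η : ℝ) :
    StronglyMeasurable ({z | η < ‖K z‖}.indicator K) :=
  hK.indicator (hK.norm.measurable measurableSet_Ioi)

theorem norm_sub_truncation_le (hη : 0 ≤ η) (z : X) :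
    ‖K z - {z | η < ‖K z‖}.indicator K z‖ ≤ η := by
  by_cases h : η < ‖K z‖
  · simp [Set.indicator_of_mem (s := {z | η < ‖K z‖}) h, hη]
  · rw [Set.indicator_of_notMem (s := {z | η < ‖K z‖}) h, sub_zero]
    exact not_lt.1 h

end Truncation

theorem lintegral_enorm_translate_sub_le {E F : Type*} [NormedAddCommGroup E]
    [MeasurableSpace E] [BorelSpace E] {μ : Measure E} [μ.IsAddHaarMeasure] [NormedAddCommGroup F]
    {f : E → F} (hf : AEStronglyMeasurable f μ) (h : E) :
    ∫⁻ x, ‖f (x - h) - f x‖ₑ ∂μ ≤ 2 * ∫⁻ x, ‖f x‖ₑ ∂μ := by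
  calc ∫⁻ x, ‖f (x - h) - f x‖ₑ ∂μ ≤ ∫⁻ x, (‖f (x - h)‖ₑ + ‖f x‖ₑ) ∂μ :=
        lintegral_mono fun x => enorm_sub_le
    _ = 2 * ∫⁻ x, ‖f x‖ₑ ∂μ := by
        rw [lintegral_add_right' _ hf.enorm, lintegral_sub_right_eq_self (fun x => ‖f x‖ₑ), two_mul]

/-- If `f = g` almost everywhere, then for almost every `x` the functions
`y ↦ f (x - t y)` and `y ↦ g (x - t y)` agree almost everywhere for any finite measure. -/
theorem ae_ae_eq_dilated_translate {E F : Type*} [NormedAddCommGroup E] [NormedSpace ℝ E]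
    [FiniteDimensional ℝ E] [MeasurableSpace E] [BorelSpace E] {μ : Measure E}
    [μ.IsAddHaarMeasure] {V : Measure E} [IsFiniteMeasure V] {f g : E → F} (hfg : f =ᵐ[μ] g)
    (t : ℝ) :
    ∀ᵐ x ∂μ, (fun y => f (x - t • y)) =ᵐ[V] fun y => g (x - t • y) := by
  obtain ⟨N, hN, hNm, hN0⟩ := exists_measurable_superset_of_null (ae_iff.1 hfg)
  have hN0' : ∀ᵐ x ∂μ, x ∉ N := measure_eq_zero_iff_ae_notMem.1 hN0
  have : ∀ᵐ x ∂μ, ∀ᵐ y ∂V, x - t • y ∉ N := by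
    rw [Measure.ae_ae_comm (p := fun x y => x - t • y ∉ N)]
    · exact ae_of_all _ fun y =>
        (measurePreserving_sub_right μ (t • y)).quasiMeasurePreserving.ae hN0'
    · exact (show Measurable fun p : E × E => p.1 - t • p.2 by fun_prop) hNm.compl
  filter_upwards [this] with x hx
  filter_upwards [hx] with y hy
  by_contra h
  exact hy (hN h)

/-! ### Translations in `L¹`, averaged over a finite measure. -/

section Translation

variable {E F : Type*} [NormedAddCommGroup E] [NormedSpace ℝ E] [FiniteDimensional ℝ E]
  [MeasurableSpace E] [BorelSpace E] {μ : Measure E} [μ.IsAddHaarMeasure]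
  [NormedAddCommGroup F]

/-- Translations act continuously on `L¹`. -/
theorem tendsto_lintegral_enorm_translate_sub {f : E → F} (hf : Integrable f μ) :
    Tendsto (fun h : E => ∫⁻ x, ‖f (x - h) - f x‖ₑ ∂μ) (𝓝 0) (𝓝 0) := by
  -- Currying makes the translations a continuous family in `C(E, E)`, so composition with them is
  -- continuous on `L¹`.
  let g : C(E, C(E, E)) := (ContinuousMap.mk (fun p : E × E => p.2 - p.1) (by fun_prop)).curry
  have hg (h : E) : MeasurePreserving (g h) μ μ := measurePreserving_sub_right μ h
  have key := ((continuous_const (y := hf.toL1 f)).compMeasurePreservingLp g.continuous hg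
    ENNReal.one_ne_top).tendsto 0
  have h0 := tendsto_iff_edist_tendsto_0.1 key
  refine h0.congr fun h => ?_
  rw [Lp.edist_def, eLpNorm_one_eq_lintegral_enorm]
  have e1 (k : E) : (Lp.compMeasurePreserving (g k) (hg k) (hf.toL1 f) : E → F)
      =ᵐ[μ] fun x => f (x - k) :=
    (Lp.coeFn_compMeasurePreserving _ (hg k)).trans
      ((hg k).quasiMeasurePreserving.ae_eq_comp hf.coeFn_toL1)
  refine lintegral_congr_ae ?_
  filter_upwards [e1 h, e1 0] with x h1 h2
  rw [Pi.sub_apply, h1, h2, sub_zero]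

variable {V : Measure E} [IsFiniteMeasure V]

/-- After Tonelli, the inner integral tends to `0` for each `y` and is at most `2 ‖f‖₁`, a constant
integrable for the finite measure `V`. -/
theorem tendsto_lintegral_lintegral_dilated_translate {f : E → F} (hfm : StronglyMeasurable f)
    (hf : Integrable f μ) :
    Tendsto (fun t : ℝ => ∫⁻ x, ∫⁻ y, ‖f (x - t • y) - f x‖ₑ ∂V ∂μ) (𝓝 0) (𝓝 0) := by
  have hm (t : ℝ) : StronglyMeasurable (fun p : E × E => f (p.1 - t • p.2) - f p.1) :=
    (hfm.comp_measurable (by fun_prop)).sub (hfm.comp_measurable measurable_fst)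
  have hswap (t : ℝ) : ∫⁻ x, ∫⁻ y, ‖f (x - t • y) - f x‖ₑ ∂V ∂μ =
      ∫⁻ y, ∫⁻ x, ‖f (x - t • y) - f x‖ₑ ∂μ ∂V :=
    lintegral_lintegral_swap (hm t).enorm.aemeasurable
  simp_rw [hswap]
  have : (0 : ℝ≥0∞) = ∫⁻ _ : E, 0 ∂V := by simp
  rw [this]
  refine tendsto_lintegral_filter_of_dominated_convergence (fun _ => 2 * ∫⁻ x, ‖f x‖ₑ ∂μ)
    (Eventually.of_forall fun t => ?_) (Eventually.of_forall fun t => ae_of_all _ fun y =>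
      lintegral_enorm_translate_sub_le hf.1 _) ?_ (ae_of_all _ fun y => ?_)
  · exact (hm t).enorm.lintegral_prod_left'
  · rw [lintegral_const]
    exact ENNReal.mul_ne_top (ENNReal.mul_ne_top (by simp) hf.2.ne) (measure_ne_top _ _)
  · refine (tendsto_lintegral_enorm_translate_sub hf).comp ?_
    exact (Continuous.tendsto' (by fun_prop) _ _ (by simp))

theorem ae_integrable_dilated_translate_of_integrable {f : E → F} (hfm : StronglyMeasurable f)
    (hf : Integrable f μ) (t : ℝ) :
    ∀ᵐ x ∂μ, Integrable (fun y => f (x - t • y)) V := by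
  have hm : StronglyMeasurable (fun p : E × E => f (p.1 - t • p.2)) :=
    hfm.comp_measurable (by fun_prop)
  have hfin : ∫⁻ x, ∫⁻ y, ‖f (x - t • y)‖ₑ ∂V ∂μ ≠ ∞ := by
    rw [lintegral_lintegral_swap hm.enorm.aemeasurable]
    have (y : E) : ∫⁻ x, ‖f (x - t • y)‖ₑ ∂μ = ∫⁻ x, ‖f x‖ₑ ∂μ :=
      lintegral_sub_right_eq_self (fun x => ‖f x‖ₑ) _
    simp_rw [this, lintegral_const]
    exact ENNReal.mul_ne_top hf.2.ne (measure_ne_top _ _)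
  filter_upwards [ae_lt_top hm.enorm.lintegral_prod_right' hfin] with x hx
  exact ⟨(hm.comp_measurable measurable_prodMk_left).aestronglyMeasurable, hx⟩

/-- The part of `K` above height `1` is in `L¹`; the rest is bounded, hence integrable for the
finite measure `V`. -/
theorem ae_integrable_dilated_translate {K : E → F} (hK : StronglyMeasurable K)
    (hKi : ∀ η : ℝ, 0 < η → Integrable ({z | η < ‖K z‖}.indicator K) μ) (t : ℝ) :
    ∀ᵐ x ∂μ, Integrable (fun y => K (x - t • y)) V := by
  filter_upwards [ae_integrable_dilated_translate_of_integrable (V := V)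
    (stronglyMeasurable_truncation hK 1) (hKi 1 one_pos) t] with x hx
  have h2 : Integrable (fun y => K (x - t • y) - {z | 1 < ‖K z‖}.indicator K (x - t • y)) V := by
    refine Integrable.of_bound ?_ 1 (ae_of_all _ fun y => norm_sub_truncation_le zero_le_one _)
    exact ((hK.sub (stronglyMeasurable_truncation hK 1)).comp_measurable
      (by fun_prop : Measurable fun y : E => x - t • y)).aestronglyMeasurable
  exact (h2.add hx).congr (ae_of_all _ fun y => by simp)

end Translation

/-! ### Concentration at the origin and convergence in measure. -/

section Concentration

variable {E F : Type*} [NormedAddCommGroup E] [NormedSpace ℝ E] [FiniteDimensional ℝ E]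
  [MeasurableSpace E] [BorelSpace E] {μ : Measure E} [μ.IsAddHaarMeasure]
  [NormedAddCommGroup F] [NormedSpace ℝ F] [CompleteSpace F]

/-- Convolving with the dilates of a finite signed measure `ν` that concentrate at the origin
converges in measure to the multiplication by `ν univ`. -/
theorem tendstoInMeasure_integral_dilated_translate {K : E → F} (hK : StronglyMeasurable K)
    (hKi : ∀ η : ℝ, 0 < η → Integrable ({z | η < ‖K z‖}.indicator K) μ)
    (ν : SignedMeasure E) :
    TendstoInMeasure μ (fun (t : ℝ) u => ∫ᵛ y, K (u - t • y) ∂<•ν) (𝓝 0)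
      (fun u => ν Set.univ • K u) := by
  have : IsFiniteMeasure ν.variation := by
    rw [← SignedMeasure.totalVariation_eq_variation]; infer_instance
  refine tendstoInMeasure_of_ne_top fun ε hε hε_top => ?_
  set B : F →L[ℝ] ℝ →L[ℝ] F := (ContinuousLinearMap.lsmul ℝ ℝ).flip with hB
  set V := ν.variation
  have hBV : 2 * (‖B‖ₑ * V Set.univ) ≠ ∞ :=
    ENNReal.mul_ne_top (by simp) (ENNReal.mul_ne_top (by simp) (measure_ne_top _ _))
  -- Truncation moves each of `K (u - t • y)` and `K u` by at most `η`; this choice keeps the total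
  -- error below `ε / 2`.
  obtain ⟨η, hη, hηε⟩ := ENNReal.exists_nnreal_pos_mul_lt hBV (ENNReal.half_pos hε.ne').ne'
  set K₁ := {z | (η : ℝ) < ‖K z‖}.indicator K with hK₁
  have hK₁m : StronglyMeasurable K₁ := stronglyMeasurable_truncation hK η
  have hbound (z : E) : ‖K z - K₁ z‖ₑ ≤ η := by
    have := norm_sub_truncation_le (K := K) η.2 z
    rw [← enorm_norm, Real.enorm_eq_ofReal (norm_nonneg _)]
    exact ENNReal.ofReal_le_of_le_toReal (by simpa using this)
  set H : ℝ → E → ℝ≥0∞ := fun t u => ∫⁻ y, ‖K₁ (u - t • y) - K₁ u‖ₑ ∂V with hH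
  have hHm (t : ℝ) : Measurable (H t) := by
    have hm : StronglyMeasurable (fun p : E × E => K₁ (p.1 - t • p.2) - K₁ p.1) :=
      (hK₁m.comp_measurable (by fun_prop)).sub (hK₁m.comp_measurable measurable_fst)
    exact hm.enorm.lintegral_prod_right'
  have hpt (t : ℝ) : ∀ᵐ u ∂μ, edist (∫ᵛ y, K (u - t • y) ∂<•ν) (ν Set.univ • K u) ≤
      ‖B‖ₑ * H t u + ε / 2 := by
    filter_upwards [ae_integrable_dilated_translate (V := V) hK hKi t] with u hu
    have hc : ν Set.univ • K u = ∫ᵛ y : E, K u ∂<•ν := by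
      rw [VectorMeasure.integral_const]; simp
    rw [hc, edist_eq_enorm_sub, ← VectorMeasure.integral_fun_sub hu (integrable_const _)]
    calc _ ≤ ‖B‖ₑ * ∫⁻ y, ‖K (u - t • y) - K u‖ₑ ∂V :=
          VectorMeasure.enorm_integral_le_lintegral_enorm
      _ ≤ ‖B‖ₑ * ∫⁻ y, (‖K₁ (u - t • y) - K₁ u‖ₑ + 2 * η) ∂V := by
          gcongr with y
          have : K (u - t • y) - K u = (K₁ (u - t • y) - K₁ u) +
              ((K (u - t • y) - K₁ (u - t • y)) - (K u - K₁ u)) := by abel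
          rw [this, two_mul]
          exact (enorm_add_le _ _).trans (add_le_add le_rfl
            (enorm_sub_le.trans (add_le_add (hbound _) (hbound _))))
      _ = ‖B‖ₑ * H t u + η * (2 * (‖B‖ₑ * V Set.univ)) := by
          rw [lintegral_add_right _ measurable_const, lintegral_const, mul_add]
          ring
      _ ≤ _ := by gcongr
  have hlim : Tendsto (fun t => ‖B‖ₑ * (∫⁻ u, H t u ∂μ) / (ε / 2)) (𝓝 0) (𝓝 0) := by
    have h1 := tendsto_lintegral_lintegral_dilated_translate (V := V) hK₁m (hKi η hη)
    have h2 := ENNReal.Tendsto.const_mul (a := ‖B‖ₑ) h1 (Or.inr (by simp))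
    have h3 := ENNReal.Tendsto.div_const h2 (b := ε / 2) (Or.inr (ENNReal.half_pos hε.ne').ne')
    simpa using h3
  refine tendsto_of_tendsto_of_tendsto_of_le_of_le tendsto_const_nhds hlim
    (fun _ => zero_le) fun t => ?_
  calc _ ≤ μ {u | ε / 2 ≤ ‖B‖ₑ * H t u} := by
        refine measure_mono_ae ?_
        filter_upwards [hpt t] with u hu hεu
        have h1 : ε / 2 + ε / 2 ≤ ‖B‖ₑ * H t u + ε / 2 := by
          rw [ENNReal.add_halves]; exact le_trans hεu hu
        exact (ENNReal.add_le_add_iff_right (ENNReal.div_lt_top hε_top (by simp)).ne).1 h1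
    _ ≤ (∫⁻ u, ‖B‖ₑ * H t u ∂μ) / (ε / 2) :=
        meas_ge_le_lintegral_div ((hHm t).const_mul _).aemeasurable
          (ENNReal.half_pos hε.ne').ne' (ENNReal.div_lt_top hε_top (by simp)).ne
    _ = _ := by rw [lintegral_const_mul _ (hHm t)]

end Concentration

/-! ### Distribution functions under convergence in measure. -/

/-- Convergence in measure implies convergence of the distribution functions at points of
continuity of the limiting distribution function. -/
theorem tendsto_measure_lt_norm_of_tendstoInMeasure {X F ι : Type*} [MeasurableSpace X]
    {μ : Measure X} [NormedAddCommGroup F] {l : Filter ι} {f : ι → X → F} {g : X → F}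
    (hfg : TendstoInMeasure μ f l g) {s : ℝ}
    (hs : ContinuousAt (fun s : ℝ => μ {x | s < ‖g x‖}) s) :
    Tendsto (fun i => μ {x | s < ‖f i x‖}) l (𝓝 (μ {x | s < ‖g x‖})) := by
  have hε (ε : ℝ) (hε : 0 < ε) := hfg (ENNReal.ofReal ε) (ENNReal.ofReal_pos.2 hε)
  have aux (ε : ℝ) (p q : F) (h : ‖p‖ + ε ≤ ‖q‖) : ENNReal.ofReal ε ≤ edist p q := by
    rw [edist_dist]
    refine ENNReal.ofReal_le_ofReal ?_
    have := norm_sub_norm_le q p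
    rw [dist_comm, dist_eq_norm]; linarith
  refine tendsto_order.2 ⟨fun a ha => ?_, fun b hb => ?_⟩
  · have h1 : ∀ᶠ ε in 𝓝 (0 : ℝ), a < μ {x | s + ε < ‖g x‖} := by
      have : Tendsto (fun ε : ℝ => s + ε) (𝓝 0) (𝓝 s) :=
        Continuous.tendsto' (by fun_prop) _ _ (by simp)
      exact (hs.tendsto.comp this).eventually_const_lt ha
    obtain ⟨ε, h1, hε0⟩ := ((h1.filter_mono nhdsWithin_le_nhds).and
      (self_mem_nhdsWithin (s := Set.Ioi 0))).exists
    have h2 := (hε ε hε0).eventually_lt_const (tsub_pos_of_lt h1)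
    filter_upwards [h2] with i hi
    have h3 : μ {x | s + ε < ‖g x‖} ≤
        μ {x | s < ‖f i x‖} + μ {x | ENNReal.ofReal ε ≤ edist (f i x) (g x)} := by
      refine (measure_mono fun x hx => ?_).trans (measure_union_le _ _)
      by_contra hcon
      simp only [Set.mem_union, Set.mem_ofPred_eq, not_or, not_lt] at hcon hx
      exact hcon.2 (aux _ _ _ (by linarith [hcon.1]))
    by_contra hcon
    have hatop : a ≠ ∞ := ha.ne_top
    have h4 : a + μ {x | ENNReal.ofReal ε ≤ edist (f i x) (g x)} < μ {x | s + ε < ‖g x‖} := by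
      rw [add_comm]
      exact lt_tsub_iff_right.1 hi
    exact absurd (h3.trans (add_le_add (not_lt.1 hcon) le_rfl)) (not_le.2 h4)
  · have h1 : ∀ᶠ ε in 𝓝 (0 : ℝ), μ {x | s - ε < ‖g x‖} < b := by
      have : Tendsto (fun ε : ℝ => s - ε) (𝓝 0) (𝓝 s) :=
        Continuous.tendsto' (by fun_prop) _ _ (by simp)
      exact (hs.tendsto.comp this).eventually_lt_const hb
    obtain ⟨ε, h1, hε0⟩ := ((h1.filter_mono nhdsWithin_le_nhds).and
      (self_mem_nhdsWithin (s := Set.Ioi 0))).exists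
    have h2 := (hε ε hε0).eventually_lt_const (tsub_pos_of_lt h1)
    filter_upwards [h2] with i hi
    have h3 : μ {x | s < ‖f i x‖} ≤
        μ {x | s - ε < ‖g x‖} + μ {x | ENNReal.ofReal ε ≤ edist (f i x) (g x)} := by
      refine (measure_mono fun x hx => ?_).trans (measure_union_le _ _)
      by_contra hcon
      simp only [Set.mem_union, Set.mem_ofPred_eq, not_or, not_lt] at hcon hx
      refine hcon.2 ?_
      rw [edist_comm]
      exact aux _ _ _ (by linarith [hcon.1])
    refine h3.trans_lt ?_
    rw [add_comm]
    exact lt_tsub_iff_right.1 hi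

/-! ### The kernel: scaling, polar coordinates, distribution function. -/

section Kernel

variable {𝕜 : Type*} [RCLike 𝕜] {n : ℕ} {Ω : Eucl n → 𝕜} {α r : ℝ}

theorem kernel_smul (hΩ : IsHomogeneousZero Ω) (α : ℝ) {t : ℝ} (ht : 0 < t) (z : Eucl n) :
    kernel Ω α (t • z) = (t ^ ((n : ℝ) - α))⁻¹ • kernel Ω α z := by
  rcases eq_or_ne z 0 with rfl | hz
  · rcases eq_or_ne ((n : ℝ) - α) 0 with h | h
    · simp [kernel, h]
    · simp [kernel, Real.zero_rpow h]
  · rw [kernel, kernel, hΩ t ht z hz, norm_smul, Real.norm_of_nonneg ht.le,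
      Real.mul_rpow ht.le (norm_nonneg _), mul_inv, smul_smul]

theorem kernel_zero (hα : α < n) : kernel Ω α 0 = 0 := by
  simp [kernel, Real.zero_rpow (sub_pos.2 hα).ne']

theorem kernel_polar (hΩ : IsHomogeneousZero Ω) (α : ℝ)
    (p : sphere (0 : Eucl n) 1 × Set.Ioi (0 : ℝ)) :
    kernel Ω α (p.2.1 • p.1.1) = (p.2.1 ^ ((n : ℝ) - α))⁻¹ • Ω p.1 := by
  rw [kernel_smul hΩ α p.2.2, kernel]
  simp

/-- Off the origin, which is null, polar coordinates turn the kernel into a radial factor times `Ω`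
on the sphere. -/
theorem aestronglyMeasurable_kernel (hΩ : IsHomogeneousZero Ω) (α : ℝ)
    (hm : AEStronglyMeasurable (fun θ : sphere (0 : Eucl n) 1 => Ω θ) (area n)) (hn : 0 < n) :
    AEStronglyMeasurable (kernel Ω α) volume := by
  have : NeZero n := ⟨hn.ne'⟩
  have h1 : AEStronglyMeasurable (fun p : sphere (0 : Eucl n) 1 × Set.Ioi (0 : ℝ) =>
      (p.2.1 ^ ((n : ℝ) - α))⁻¹ • Ω p.1)
      ((area n).prod (Measure.volumeIoiPow (Module.finrank ℝ (Eucl n) - 1))) := by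
    refine AEStronglyMeasurable.smul ?_ (hm.comp_fst)
    have : Measurable fun p : sphere (0 : Eucl n) 1 × Set.Ioi (0 : ℝ) =>
        (p.2.1 ^ ((n : ℝ) - α))⁻¹ :=
      ((measurable_subtype_coe.comp measurable_snd).pow_const _).inv
    exact this.aestronglyMeasurable
  have h2 := h1.comp_measurePreserving
    (volume : Measure (Eucl n)).measurePreserving_homeomorphUnitSphereProd
  rw [← restrict_compl_singleton (μ := (volume : Measure (Eucl n))) 0,
    ← map_comap_subtype_coe (measurableSet_singleton (0 : Eucl n)).compl,
    (MeasurableEmbedding.subtype_coe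
      (measurableSet_singleton (0 : Eucl n)).compl).aestronglyMeasurable_map_iff]
  convert h2 using 1
  ext x
  simp only [Function.comp_apply]
  rw [← kernel_polar hΩ, ← homeomorphUnitSphereProd_symm_apply_coe, Homeomorph.symm_apply_apply]

/-- The volume of a set avoiding the origin, in polar coordinates. -/
theorem volume_eq_polar {S : Set (Eucl n)} (hS : (0 : Eucl n) ∉ S) :
    volume S = (area n).prod (Measure.volumeIoiPow (Module.finrank ℝ (Eucl n) - 1))
      {p | p.2.1 • p.1.1 ∈ S} := by
  rw [← (volume : Measure (Eucl n)).measurePreserving_homeomorphUnitSphereProd.measure_preimage_emb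
    (Homeomorph.measurableEmbedding _),
    comap_subtype_coe_apply (measurableSet_singleton (0 : Eucl n)).compl]
  congr 1
  ext x
  simp only [Set.mem_image, Set.mem_preimage, Set.mem_ofPred_eq,
    ← homeomorphUnitSphereProd_symm_apply_coe, Homeomorph.symm_apply_apply]
  constructor
  · intro hx
    exact ⟨⟨x, fun h => hS (by rwa [Set.mem_singleton_iff.1 h] at hx)⟩, hx, rfl⟩
  · rintro ⟨y, hy, rfl⟩
    exact hy

/-- The set is the interval `ρ < R` with `R = (c / s) ^ (1/(n-α))`; its mass for `ρ ^ (n-1) dρ` is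
`R ^ n / n`, and `R ^ n = (c / s) ^ r`. -/
theorem volumeIoiPow_radial_superlevel (hn : 0 < n) (hα : α < n) (hr : r = n / (n - α))
    {c s : ℝ} (hc : 0 ≤ c) (hs : 0 < s) :
    Measure.volumeIoiPow (n - 1) {ρ | s < (ρ.1 ^ ((n : ℝ) - α))⁻¹ * c} =
      ENNReal.ofReal (s ^ (-r)) * ((n : ℝ≥0∞)⁻¹ * ENNReal.ofReal c ^ r) := by
  have hβ : 0 < (n : ℝ) - α := sub_pos.2 hα
  have hn' : (0 : ℝ) < n := by exact_mod_cast hn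
  have hr0 : 0 < r := hr ▸ div_pos hn' hβ
  rcases hc.eq_or_lt with rfl | hc
  · simp [hs.le.not_gt, hr0]
  have hcs : 0 < c / s := div_pos hc hs
  have hset : {ρ : Set.Ioi (0 : ℝ) | s < (ρ.1 ^ ((n : ℝ) - α))⁻¹ * c} =
      Set.Iio ⟨(c / s) ^ ((n : ℝ) - α)⁻¹, Set.mem_Ioi.2 (Real.rpow_pos_of_pos hcs _)⟩ := by
    ext ρ
    have hρ : 0 < ρ.1 := ρ.2
    rw [Set.mem_Iio, ← Subtype.coe_lt_coe, Real.lt_rpow_inv_iff_of_pos hρ.le hcs.le hβ,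
      Set.mem_ofPred_eq, inv_mul_eq_div, lt_div_iff₀ (Real.rpow_pos_of_pos hρ _), lt_div_iff₀ hs,
      mul_comm]
  rw [hset, Measure.volumeIoiPow_apply_Iio, Nat.sub_add_cancel hn]
  have hcast : ((n - 1 : ℕ) : ℝ) + 1 = n := by
    rw [Nat.cast_sub hn]; simp
  have hpow : ((c / s) ^ ((n : ℝ) - α)⁻¹) ^ n = s ^ (-r) * c ^ r := by
    rw [← Real.rpow_natCast, ← Real.rpow_mul hcs.le, inv_mul_eq_div, ← hr,
      Real.div_rpow hc.le hs.le, Real.rpow_neg hs.le, div_eq_inv_mul]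
  rw [hcast]
  simp only []
  rw [hpow, ENNReal.ofReal_div_of_pos hn', ENNReal.ofReal_mul (Real.rpow_nonneg hs.le _),
    ENNReal.ofReal_natCast, ENNReal.ofReal_rpow_of_nonneg hc.le hr0.le, div_eq_mul_inv, mul_assoc,
    mul_comm (n : ℝ≥0∞)⁻¹]

theorem prod_volumeIoiPow_superlevel {X : Type*} [MeasurableSpace X] (σ : Measure X) (hn : 0 < n)
    (hα : α < n) (hr : r = n / (n - α)) {f : X → ℝ} (hf : Measurable f) (hf0 : ∀ x, 0 ≤ f x)
    {s : ℝ} (hs : 0 < s) :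
    σ.prod (Measure.volumeIoiPow (n - 1)) {p | s < (p.2.1 ^ ((n : ℝ) - α))⁻¹ * f p.1} =
      ENNReal.ofReal (s ^ (-r)) * ((n : ℝ≥0∞)⁻¹ * ∫⁻ x, ENNReal.ofReal (f x) ^ r ∂σ) := by
  have hmeas : MeasurableSet {p : X × Set.Ioi (0 : ℝ) |
      s < (p.2.1 ^ ((n : ℝ) - α))⁻¹ * f p.1} :=
    measurableSet_lt measurable_const
      ((((measurable_subtype_coe.comp measurable_snd).pow_const _).inv).mul
        (hf.comp measurable_fst))
  have hfin : (n : ℝ≥0∞)⁻¹ ≠ ∞ := by simp [hn.ne']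
  rw [Measure.prod_apply hmeas, ← lintegral_const_mul' _ _ hfin,
    ← lintegral_const_mul' _ _ ENNReal.ofReal_ne_top]
  exact lintegral_congr fun x => volumeIoiPow_radial_superlevel hn hα hr (hf0 x) hs

/-- The distribution function of the kernel `Ω(z) / |z|^(n-α)`. -/
theorem volume_lt_norm_kernel (hΩ : IsHomogeneousZero Ω) (hn : 0 < n) (hα : α < n)
    (hr : r = n / (n - α))
    (hm : AEStronglyMeasurable (fun θ : sphere (0 : Eucl n) 1 => Ω θ) (area n))
    {s : ℝ} (hs : 0 < s) :
    volume {z | s < ‖kernel Ω α z‖} = ENNReal.ofReal (s ^ (-r)) * ((n : ℝ≥0∞)⁻¹ *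
      eLpNorm (fun θ : sphere (0 : Eucl n) 1 => Ω θ) (ENNReal.ofReal r) (area n) ^ r) := by
  have hβ : 0 < (n : ℝ) - α := sub_pos.2 hα
  have hr0 : 0 < r := hr ▸ div_pos (by exact_mod_cast hn) hβ
  obtain ⟨Ω', hΩ'm, hΩ'⟩ := hm
  have hnorm : eLpNorm (fun θ : sphere (0 : Eucl n) 1 => Ω θ) (ENNReal.ofReal r) (area n) ^ r =
      ∫⁻ θ, ENNReal.ofReal ‖Ω' θ‖ ^ r ∂(area n) := by
    simp_rw [ofReal_norm]
    rw [eLpNorm_congr_ae hΩ', eLpNorm_eq_lintegral_rpow_enorm_toReal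
      (ENNReal.ofReal_pos.2 hr0).ne' ENNReal.ofReal_ne_top, ENNReal.toReal_ofReal hr0.le,
      ← ENNReal.rpow_mul, one_div_mul_cancel hr0.ne', ENNReal.rpow_one]
  rw [volume_eq_polar (by simp [kernel_zero hα, hs.le]), finrank_euclideanSpace_fin, hnorm,
    ← prod_volumeIoiPow_superlevel (area n) hn hα hr hΩ'm.norm.measurable
      (fun θ => norm_nonneg (Ω' θ)) hs]
  refine measure_congr ?_
  filter_upwards [Measure.quasiMeasurePreserving_fst.ae_eq_comp hΩ'] with p hp
  have hp' : Ω p.1 = Ω' p.1 := hp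
  refine propext ?_
  change s < ‖kernel Ω α (p.2.1 • p.1.1)‖ ↔ s < (p.2.1 ^ ((n : ℝ) - α))⁻¹ * ‖Ω' p.1‖
  rw [kernel_polar hΩ, norm_smul, hp',
    Real.norm_of_nonneg (inv_nonneg.2 (Real.rpow_nonneg (le_of_lt p.2.2) _))]

/-- A function whose distribution function decays like `s ^ (-r)` with `r > 1` has integrable
upper truncations. -/
theorem integrable_truncation_of_measure_lt_norm_le {X F : Type*} [MeasurableSpace X]
    [NormedAddCommGroup F] {μ : Measure X} {K : X → F} (hK : StronglyMeasurable K) {r : ℝ}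
    (hr : 1 < r) {C : ℝ≥0∞} (hC : C ≠ ∞)
    (hKC : ∀ s : ℝ, 0 < s → μ {z | s < ‖K z‖} ≤ ENNReal.ofReal (s ^ (-r)) * C)
    {η : ℝ} (hη : 0 < η) :
    Integrable ({z | η < ‖K z‖}.indicator K) μ := by
  have hm := stronglyMeasurable_truncation hK η
  refine ⟨hm.aestronglyMeasurable, ?_⟩
  have hsub (s : ℝ) (hs : 0 < s) : {z | s < ‖{z | η < ‖K z‖}.indicator K z‖} ⊆
      {z | η < ‖K z‖} ∩ {z | s < ‖K z‖} := by
    intro z hz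
    by_cases h : η < ‖K z‖
    · refine ⟨h, ?_⟩
      simpa [Set.indicator_of_mem (s := {z | η < ‖K z‖}) h] using hz
    · rw [Set.mem_ofPred_eq, Set.indicator_of_notMem (s := {z | η < ‖K z‖}) h, norm_zero] at hz
      exact absurd hz hs.le.not_gt
  -- Layer-cake formula: on `(0, η]` the distribution function is at most that of `K` at `η`; beyond
  -- `η`, `s ^ (-r)` is integrable.
  rw [hasFiniteIntegral_iff_norm, lintegral_eq_lintegral_meas_lt _
    (ae_of_all _ fun _ => norm_nonneg _) hm.norm.measurable.aemeasurable,
    ← Set.Ioc_union_Ioi_eq_Ioi hη.le]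
  refine (lintegral_union_le _ _ _).trans_lt (ENNReal.add_lt_top.2 ⟨?_, ?_⟩)
  · calc _ ≤ ∫⁻ _ in Set.Ioc 0 η, ENNReal.ofReal (η ^ (-r)) * C :=
        setLIntegral_mono measurable_const fun s hs =>
          (measure_mono ((hsub s hs.1).trans Set.inter_subset_left)).trans (hKC η hη)
      _ < ∞ := by
        rw [setLIntegral_const]
        exact ENNReal.mul_lt_top (ENNReal.mul_lt_top ENNReal.ofReal_lt_top hC.lt_top) (by simp)
  · calc _ ≤ ∫⁻ s in Set.Ioi η, ENNReal.ofReal (s ^ (-r)) * C :=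
        setLIntegral_mono (by fun_prop) fun s hs =>
          (measure_mono ((hsub s (hη.trans hs)).trans Set.inter_subset_right)).trans
            (hKC s (hη.trans hs))
      _ < ∞ := by
        rw [lintegral_mul_const' _ _ hC]
        refine ENNReal.mul_lt_top ?_ hC.lt_top
        exact (integrableOn_Ioi_rpow_of_lt (by linarith) hη).lintegral_lt_top

theorem fracIntegral_eq_smul (hΩ : IsHomogeneousZero Ω) (α : ℝ) (ν : SignedMeasure (Eucl n))
    {t : ℝ} (ht : 0 < t) (x : Eucl n) :
    fracIntegral Ω α ν x = t ^ ((n : ℝ) - α) • ∫ᵛ y, kernel Ω α (t • x - t • y) ∂<•ν := by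
  rw [fracIntegral, ← VectorMeasure.integral_fun_smul]
  simp_rw [← smul_sub, kernel_smul hΩ α ht,
    smul_inv_smul₀ (Real.rpow_pos_of_pos ht ((n : ℝ) - α)).ne']

/-- The level sets of `fracIntegral` are dilates of the unit level sets of the integrals against
the dilated measures. -/
theorem volume_lt_norm_fracIntegral (hΩ : IsHomogeneousZero Ω) (hα : α < n)
    (hr : r = n / (n - α)) (ν : SignedMeasure (Eucl n)) {s : ℝ} (hs : 0 < s) :
    ENNReal.ofReal (s ^ r) * volume {x | s < ‖fracIntegral Ω α ν x‖} =
      volume {u : Eucl n | 1 < ‖∫ᵛ y, kernel Ω α (u - s ^ ((n : ℝ) - α)⁻¹ • y) ∂<•ν‖} := by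
  have hβ : 0 < (n : ℝ) - α := sub_pos.2 hα
  set t := s ^ ((n : ℝ) - α)⁻¹ with ht_def
  have ht : 0 < t := Real.rpow_pos_of_pos hs _
  have hts : t ^ ((n : ℝ) - α) = s := Real.rpow_inv_rpow hs.le hβ.ne'
  have htn : t ^ n = s ^ r := by
    rw [ht_def, ← Real.rpow_natCast, ← Real.rpow_mul hs.le, inv_mul_eq_div, hr]
  have hset : {x | s < ‖fracIntegral Ω α ν x‖} =
      (t • ·) ⁻¹' {u : Eucl n | 1 < ‖∫ᵛ y, kernel Ω α (u - t • y) ∂<•ν‖} := by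
    ext x
    rw [Set.mem_preimage, Set.mem_ofPred_eq, Set.mem_ofPred_eq, fracIntegral_eq_smul hΩ α ν ht,
      norm_smul, hts, Real.norm_of_nonneg hs.le, lt_mul_iff_one_lt_right hs]
  rw [hset, Measure.addHaar_preimage_smul _ ht.ne', finrank_euclideanSpace_fin, htn,
    abs_of_pos (inv_pos.2 (Real.rpow_pos_of_pos hs _)), ← mul_assoc,
    ← ENNReal.ofReal_mul (Real.rpow_nonneg hs.le _),
    mul_inv_cancel₀ (Real.rpow_pos_of_pos hs _).ne', ENNReal.ofReal_one, one_mul]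

end Kernel

end FractionalRough

/-! ### The main theorem. -/

open FractionalRough in
theorem theoremt {𝕜 : Type*} [RCLike 𝕜] (n : ℕ) (α r : ℝ) (hα : 0 < α) (hαn : α < n)
    (hr : r = n / (n - α))
    (Ω : FractionalRough.Eucl n → 𝕜)
    (hΩ_hom : FractionalRough.IsHomogeneousZero Ω)
    (hΩ_mean : ∫ θ : sphere (0 : FractionalRough.Eucl n) 1, Ω θ ∂(FractionalRough.area n) = 0)
    (hΩ_dini : FractionalRough.DiniCondition (ENNReal.ofReal r) α Ω)
    (ν : SignedMeasure (FractionalRough.Eucl n))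
    (hν : VectorMeasure.AbsolutelyContinuous ν
      (volume : Measure (FractionalRough.Eucl n)).toENNRealVectorMeasure) :
    -- the integral defining `T_{Ω,α} ν (x)` converges absolutely for almost every `x`
    (∀ᵐ x : FractionalRough.Eucl n,
      Integrable (fun y => FractionalRough.kernel Ω α (x - y)) ν.totalVariation) ∧
    Tendsto
      (fun t : ℝ => ENNReal.ofReal (t ^ r) *
        volume {x : FractionalRough.Eucl n | t < ‖FractionalRough.fracIntegral Ω α ν x‖})
      (𝓝[>] 0)
      (𝓝 ((n : ℝ≥0∞)⁻¹ *
        eLpNorm (fun θ : sphere (0 : FractionalRough.Eucl n) 1 => Ω θ) (ENNReal.ofReal r)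
          (FractionalRough.area n) ^ r *
        ENNReal.ofReal (|ν Set.univ| ^ r))) := by
  have hn' : (0 : ℝ) < n := hα.trans hαn
  have hn : 0 < n := by exact_mod_cast hn'
  have hβ : 0 < (n : ℝ) - α := sub_pos.2 hαn
  have hr1 : 1 < r := by rw [hr, one_lt_div hβ]; linarith
  have hr0 : 0 < r := one_pos.trans hr1
  have hm := hΩ_dini.memLp.1
  set C : ℝ≥0∞ := (n : ℝ≥0∞)⁻¹ * eLpNorm (fun θ : sphere (0 : Eucl n) 1 => Ω θ)
    (ENNReal.ofReal r) (area n) ^ r with hC_def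
  have hC : C ≠ ∞ := ENNReal.mul_ne_top (by simp [hn.ne'])
    (ENNReal.rpow_ne_top_of_nonneg hr0.le hΩ_dini.memLp.2.ne)
  have hdist (s : ℝ) (hs : 0 < s) :
      volume {z | s < ‖kernel Ω α z‖} = ENNReal.ofReal (s ^ (-r)) * C :=
    volume_lt_norm_kernel hΩ_hom hn hαn hr hm hs
  have hKm := aestronglyMeasurable_kernel hΩ_hom α hm hn
  -- Tonelli needs a genuinely measurable kernel; `ae_ae_eq_dilated_translate` carries the results
  -- back from this representative.
  set K := hKm.mk with hK_def
  have hK : StronglyMeasurable K := hKm.stronglyMeasurable_mk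
  have hKae : kernel Ω α =ᵐ[volume] K := hKm.ae_eq_mk
  have hdistK (s : ℝ) (hs : 0 < s) :
      volume {z | s < ‖K z‖} = ENNReal.ofReal (s ^ (-r)) * C := by
    rw [← hdist s hs]
    refine measure_congr ?_
    filter_upwards [hKae] with z hz
    refine propext ?_
    change s < ‖K z‖ ↔ s < ‖kernel Ω α z‖
    rw [hz]
  have hKi (η : ℝ) (hη : 0 < η) : Integrable ({z | η < ‖K z‖}.indicator K) volume :=
    integrable_truncation_of_measure_lt_norm_le hK hr1 hC (fun s hs => (hdistK s hs).le) hη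
  refine ⟨?_, ?_⟩
  · filter_upwards [ae_integrable_dilated_translate (V := ν.totalVariation) hK hKi 1,
      ae_ae_eq_dilated_translate (V := ν.totalVariation) hKae 1] with x hx hx'
    simpa using hx.congr hx'.symm
  · have hfin : IsFiniteMeasure ν.variation := by
      rw [← SignedMeasure.totalVariation_eq_variation]; infer_instance
    set a := ν Set.univ with ha_def
    have hG (s : ℝ) (hs : 0 < s) : volume {u | s < ‖a • K u‖} =
        ENNReal.ofReal (s ^ (-r)) * (C * ENNReal.ofReal (|a| ^ r)) := by
      rcases eq_or_ne a 0 with ha | ha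
      -- When `ν(ℝⁿ) = 0` both sides vanish, since `0 ^ r = 0` for `r ≠ 0`.
      · simp [ha, hs.le.not_gt, Real.zero_rpow hr0.ne']
      · have ha' : 0 < |a| := abs_pos.2 ha
        have : {u | s < ‖a • K u‖} = {u | s / |a| < ‖K u‖} := by
          ext u
          rw [Set.mem_ofPred_eq, Set.mem_ofPred_eq, norm_smul, Real.norm_eq_abs, div_lt_iff₀ ha',
            mul_comm]
        rw [this, hdistK _ (div_pos hs ha'), Real.div_rpow hs.le ha'.le, Real.rpow_neg ha'.le,
          div_inv_eq_mul, ENNReal.ofReal_mul (Real.rpow_nonneg hs.le _)]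
        ring
    have hcont : ContinuousAt (fun s : ℝ => volume {u | s < ‖a • K u‖}) 1 := by
      have h1 : ContinuousAt (fun s : ℝ =>
          ENNReal.ofReal (s ^ (-r)) * (C * ENNReal.ofReal (|a| ^ r))) 1 :=
        ENNReal.Tendsto.mul_const (ENNReal.continuous_ofReal.continuousAt.comp
          (Real.continuousAt_rpow_const _ _ (Or.inl one_ne_zero)))
          (Or.inr (ENNReal.mul_ne_top hC ENNReal.ofReal_ne_top))
      refine h1.congr ?_
      filter_upwards [eventually_gt_nhds one_pos] with s hs using (hG s hs).symm
    have hlim := tendsto_measure_lt_norm_of_tendstoInMeasure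
      (tendstoInMeasure_integral_dilated_translate hK hKi ν) hcont
    rw [hG 1 one_pos, Real.one_rpow, ENNReal.ofReal_one, one_mul] at hlim
    have hscale : Tendsto (fun s : ℝ => s ^ ((n : ℝ) - α)⁻¹) (𝓝[>] 0) (𝓝 0) := by
      have := (Real.continuousAt_rpow_const 0 ((n : ℝ) - α)⁻¹ (Or.inr (inv_nonneg.2 hβ.le))).tendsto
      rw [Real.zero_rpow (inv_pos.2 hβ).ne'] at this
      exact this.mono_left nhdsWithin_le_nhds
    refine (hlim.comp hscale).congr' ?_
    filter_upwards [self_mem_nhdsWithin] with s hs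
    rw [volume_lt_norm_fracIntegral hΩ_hom hαn hr ν hs]
    refine measure_congr ?_
    filter_upwards [ae_ae_eq_dilated_translate (V := ν.variation) hKae
      (s ^ ((n : ℝ) - α)⁻¹)] with u hu
    refine propext ?_
    change 1 < ‖∫ᵛ y, K (u - s ^ ((n : ℝ) - α)⁻¹ • y) ∂<•ν‖ ↔
      1 < ‖∫ᵛ y, kernel Ω α (u - s ^ ((n : ℝ) - α)⁻¹ • y) ∂<•ν‖
    rw [VectorMeasure.integral_congr_ae hu]
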